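/- **Setting.** Let $n\ge 2$ and let $G$ be a strongly connected digraph without self-edges on the nodes $v_1,\dots,v_n$. Let $\mathcal N_j^+$ be the set of out-neighbours of $v_j$, $D_j=|\mathcal N_j^+|$, and $D=\max_j D_j$. Each node $v_j$ has an initial state $y_j\in\mathbb Z$. Put $q=\frac1n\sum_j y_j$ and $$y^{init}=\sum_{j:\,y_j>\lceil q\rceil}(y_j-\lceil q\rceil)+\sum_{j:\,y_j<\lfloor q\rfloor}(\lfloor q\rfloor-y_j).$$ **Algorithm (randomized quantized mass splitting).** Initially $y_j[0]=2y_j$ and $z_j[0]=2$ for every $j$. At each time step $k=0,1,2,\dots$ every node $v_j$ does the following. If $z_j[k]>1$, it sets $q^s_j[k]=\lfloor y_j[k]/z_j[k]\rfloor$ and splits $y_j[k]$ into $z_j[k]$ integer pieces, each equal to $\lfloor y_j[k]/z_j[k]\rfloor$ or to $\lfloor y_j[k]/z_j[k]\rfloor+1$ and with sum $y_j[k]$. It keeps one piece of the minimum value $\lfloor y_j[k]/z_j[k]\rfloor$ and sends each of the other $z_j[k]-1$ pieces to a node chosen uniformly at random in $\mathcal N_j^+\cup\{v_j\}$; all choices,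 over all pieces, nodes and times, are independent. If $z_j[k]\le 1$, it keeps its whole mass and $q^s_j[k]=q^s_j[k-1]$. Then $y_j[k+1]$ is the sum of the pieces that $v_j$ has kept or received, and $z_j[k+1]$ is their number. **Theorem.** For every $0<\varepsilon<1$ there is a finite $k_0\in\mathbb Z_{\ge0}$ such that, with probability at least $(1-\varepsilon)^{y^{init}+n}$, for every node $v_j$ either $q^s_j[k]=\lfloor q\rfloor$ for all $k\ge k_0$, or $q^s_j[k]=\lceil q\rceil$ for all $k\ge k_0$. Moreover $k_0$ can be taken of order $(y^{init}+n)\,\tau\,(n-1)$, where $$\tau=\left\lceil\frac{\log\varepsilon}{\log\bigl(1-(1+D)^{-(n-1)}\bigr)}\right\rceil .$$ That is, for every $\varepsilon_0<1$ there is a constant $C$, depending only on $\varepsilon_0$, such that for all $n\ge2$, all such digraphs, all integer initial states and all $0<\varepsilon\le\varepsilon_0$, the statement above holds with some $k_0\le C\,(y^{init}+n)\,\tau\,(n-1)$. -/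

import Mathlib

noncomputable section

namespace MassSplitting

open MeasureTheory

/- Digraphs on the node set `Fin n`. `G.Adj j l` means that there is an edge from `j` to `l`, that is,
`j` can transmit to `l`. -/

/-- From every node there is a directed path to every other node. -/
def StronglyConnected {n : ℕ} (G : Digraph (Fin n)) : Prop :=
  ∀ i j : Fin n, Relation.ReflTransGen G.Adj i j

open Classical in
/-- The set of out-neighbours of node `j`. -/
def outNeighbors {n : ℕ} (G : Digraph (Fin n)) (j : Fin n) : Finset (Fin n) :=
  Finset.univ.filter fun l => G.Adj j l

/-- The out-degree of node `j`. -/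
def outDegree {n : ℕ} (G : Digraph (Fin n)) (j : Fin n) : ℕ := (outNeighbors G j).card

/-- The maximum out-degree. -/
def maxOutDegree {n : ℕ} (G : Digraph (Fin n)) : ℕ := Finset.univ.sup (outDegree G)

/-- The law of one random choice made by node `j`: uniform on its out-neighbours and `j` itself. -/
def choiceLaw {n : ℕ} (G : Digraph (Fin n)) (j : Fin n) : PMF (Fin n) :=
  PMF.uniformOfFinset (insert j (outNeighbors G j)) (Finset.insert_nonempty _ _)

/-- A realization of all the random choices: `ω (k, j, i)` is the destination drawn by node `j`, at
time step `k`, for the piece number `i` that it sends out. Draws that are not needed are ignored. -/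
abbrev Choices (n : ℕ) : Type := ℕ × Fin n × ℕ → Fin n

/-- All choices are independent, those of node `j` having law `choiceLaw G j`. -/
def choiceMeasure {n : ℕ} (G : Digraph (Fin n)) : Measure (Choices n) :=
  Measure.infinitePi fun a : ℕ × Fin n × ℕ => (choiceLaw G a.2.1).toMeasure

/-- The mass variables `y`, `z` of a node. -/
structure Mass where
  y : ℤ
  z : ℕ

/-- The state variables `yˢ`, `zˢ`, `qˢ` of a node. -/
structure StateVars where
  ys : ℤ
  zs : ℕ
  qs : ℤ

/-- If `z > 1`, the mass `y` is split into `z` integer pieces that differ by at most one. The pieces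
numbered `0, …, z - 2` are sent out; piece `i` has this value: the floor `⌊y / z⌋`, plus one for the
first `y - z ⌊y / z⌋` of them. The last piece has the minimum value `⌊y / z⌋` and is kept. -/
def sentPiece (m : Mass) (i : ℕ) : ℤ :=
  m.y / (m.z : ℤ) + if (i : ℤ) < m.y % (m.z : ℤ) then 1 else 0

/-- The transmission variable `cʸ` from node `j` to node `l`, where `j` has mass `m` and
draws the destinations `d 0, d 1, …` for its pieces. A node with `z ≤ 1` keeps all of its mass. -/
def sentY {n : ℕ} (j : Fin n) (m : Mass) (d : ℕ → Fin n) (l : Fin n) : ℤ :=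
  if 1 < m.z then
    (∑ i ∈ (Finset.range (m.z - 1)).filter (fun i => d i = l), sentPiece m i)
      + if l = j then m.y / (m.z : ℤ) else 0
  else if l = j then m.y else 0

/-- The transmission variable `cᶻ` from node `j` to node `l`: the number of pieces sent. -/
def sentZ {n : ℕ} (j : Fin n) (m : Mass) (d : ℕ → Fin n) (l : Fin n) : ℕ :=
  if 1 < m.z then
    ((Finset.range (m.z - 1)).filter (fun i => d i = l)).card + if l = j then 1 else 0
  else if l = j then m.z else 0

/-- The mass variables of all nodes at time step `k`: `y = 2 y₀`, `z = 2` at `k = 0`; then each node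
adds up what it keeps and what it receives. (The sums run over all nodes `i`, as nothing is sent to a
node that is not an out-neighbour, outside an event of probability zero.) -/
def mass {n : ℕ} (y₀ : Fin n → ℤ) (ω : Choices n) : ℕ → Fin n → Mass
  | 0, j => ⟨2 * y₀ j, 2⟩
  | k + 1, j =>
    ⟨∑ i, sentY i (mass y₀ ω k i) (fun r => ω (k, i, r)) j,
     ∑ i, sentZ i (mass y₀ ω k i) (fun r => ω (k, i, r)) j⟩

/-- The state variables are refreshed from the mass variables when `z > 1`, else left unchanged. -/
def refresh (m : Mass) (old : StateVars) : StateVars :=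
  if 1 < m.z then ⟨m.y, m.z, m.y / (m.z : ℤ)⟩ else old

/-- The state variables of all nodes at time step `k`. The zero values from which they start are
overwritten at time step `0`, as then `z = 2`. -/
def stateVars {n : ℕ} (y₀ : Fin n → ℤ) (ω : Choices n) : ℕ → Fin n → StateVars
  | 0, j => refresh (mass y₀ ω 0 j) ⟨0, 0, 0⟩
  | k + 1, j => refresh (mass y₀ ω (k + 1) j) (stateVars y₀ ω k j)

/-- The real average of the initial states. -/
def average {n : ℕ} (y₀ : Fin n → ℤ) : ℝ := (∑ j, (y₀ j : ℝ)) / n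

/-- The total initial deviation from the interval `[⌊q⌋, ⌈q⌉]`. -/
def yInit {n : ℕ} (y₀ : Fin n → ℤ) : ℕ :=
  (∑ j with ⌈average y₀⌉ < y₀ j, (y₀ j - ⌈average y₀⌉).toNat)
    + ∑ j with y₀ j < ⌊average y₀⌋, (⌊average y₀⌋ - y₀ j).toNat

/-- From time step `k₀` on, the state `qˢ` of each node is constantly `⌊q⌋` or constantly `⌈q⌉`. -/
def SettledFrom {n : ℕ} (y₀ : Fin n → ℤ) (ω : Choices n) (k₀ : ℕ) : Prop :=
  ∀ j : Fin n,
    (∀ k, k₀ ≤ k → (stateVars y₀ ω k j).qs = ⌊average y₀⌋) ∨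
    (∀ k, k₀ ≤ k → (stateVars y₀ ω k j).qs = ⌈average y₀⌉)

/-- The number of windows
`τ = ⌈log ε / log (1 - (1 + D)^(-(n-1)))⌉`, where `D` is the maximum out-degree. -/
def windows {n : ℕ} (G : Digraph (Fin n)) (ε : ℝ) : ℕ :=
  ⌈Real.log ε / Real.log (1 - ((1 + (maxOutDegree G : ℝ)) ^ (n - 1))⁻¹)⌉₊

end MassSplitting

end

/-! Fix an integer `t` and charge each piece with its value minus `t`, so that `weight t` is the
charge of a node. An even split never straddles `t`, so the pieces of one node never carry opposite
signs. Total charge is conserved, and positive charge is lost only when opposite charges meet at a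
node; hence `imbalance t` never grows. Imbalance zero at both `c = ⌈q⌉` and `f = ⌊q⌋` forces every
`y / z` to be `f` or `c`.

It remains to freeze which nodes show `c`. These are the nodes of charge zero for `c`, the exact
ones. Once balanced, a non-exact node keeps a negative piece, so exact nodes can only be lost. At
least `n` minus the conserved deficit of them always remain, and at that minimum nothing changes any
more.

`rank` measures both phases and never increases. While it is positive there is a `Pursuit`: a moving
piece whose arrival at a suitable node `b` forces a decrease, and which stays available until the
decrease happens. Steering one piece along a path of `n - 1` moves, waiting allowed, has probability
at least `p = (1 + D)^(-(n-1))` (`rank_decreases`).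

The initial rank is at most `6 * (yInit y₀ + n)`. Granting each unit `(m + 1) * τ` windows of `n -
1` steps makes its failure probability at most `ε ^ (m + 1) ≤ ε / 6`, and Bernoulli's inequality
gives `(1 - ε / 6) ^ 6 ≥ 1 - ε`. -/

noncomputable section

namespace MassSplitting

open MeasureTheory

/-! ### One time step: signs of the pieces and conservation laws -/

section Dynamics

variable {n : ℕ}

/-- The excess of a mass over the value `t` for each of its pieces. -/
def weight (t : ℤ) (m : Mass) : ℤ := m.y - t * m.z

/-- The excess over `t` of the pieces sent from `j` to `l`. -/
def sentW (t : ℤ) (j : Fin n) (m : Mass) (d : ℕ → Fin n) (l : Fin n) : ℤ :=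
  sentY j m d l - t * sentZ j m d l

/-- One time step of the algorithm. -/
def step (s : Fin n → Mass) (x : Fin n × ℕ → Fin n) (j : Fin n) : Mass :=
  ⟨∑ i, sentY i (s i) (fun r => x (i, r)) j, ∑ i, sentZ i (s i) (fun r => x (i, r)) j⟩

theorem weight_step (t : ℤ) (s : Fin n → Mass) (x : Fin n × ℕ → Fin n) (l : Fin n) :
    weight t (step s x l) = ∑ i, sentW t i (s i) (fun r => x (i, r)) l := by
  simp [weight, step, sentW, Finset.sum_sub_distrib, Finset.mul_sum]

theorem sentW_of_one_lt (t : ℤ) (j : Fin n) {m : Mass} (hm : 1 < m.z) (d : ℕ → Fin n)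
    (l : Fin n) :
    sentW t j m d l = (∑ i ∈ (Finset.range (m.z - 1)).filter (fun i => d i = l),
      (sentPiece m i - t)) + if l = j then m.y / (m.z : ℤ) - t else 0 := by
  simp only [sentW, sentY, sentZ, if_pos hm, Finset.sum_sub_distrib, Finset.sum_const, nsmul_eq_mul]
  split_ifs <;> push_cast <;> ring

theorem sentW_of_le_one (t : ℤ) (j : Fin n) {m : Mass} (hm : m.z ≤ 1) (d : ℕ → Fin n)
    (l : Fin n) : sentW t j m d l = if l = j then weight t m else 0 := by
  simp only [sentW, sentY, sentZ, if_neg (not_lt.2 hm), weight]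
  split_ifs <;> simp

theorem le_div_of_weight_nonneg {t : ℤ} {m : Mass} (hz : 1 ≤ m.z) (hw : 0 ≤ weight t m) :
    t ≤ m.y / (m.z : ℤ) := by
  rw [Int.le_ediv_iff_mul_le (by exact_mod_cast hz)]
  unfold weight at hw
  linarith

theorem div_lt_of_weight_neg {t : ℤ} {m : Mass} (hz : 1 ≤ m.z) (hw : weight t m < 0) :
    m.y / (m.z : ℤ) < t := by
  rw [Int.ediv_lt_iff_lt_mul (by exact_mod_cast hz)]
  unfold weight at hw
  linarith

theorem div_le_of_weight_nonpos {t : ℤ} {m : Mass} (hz : 1 ≤ m.z) (hw : weight t m ≤ 0) :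
    m.y / (m.z : ℤ) ≤ t := by
  have h : m.y / (m.z : ℤ) < t + 1 := by
    rw [Int.ediv_lt_iff_lt_mul (by exact_mod_cast hz)]
    unfold weight at hw
    have : (1 : ℤ) ≤ m.z := by exact_mod_cast hz
    nlinarith
  omega

theorem sentPiece_nonneg {t : ℤ} {m : Mass} (hz : 1 ≤ m.z) (hw : 0 ≤ weight t m) (i : ℕ) :
    t ≤ sentPiece m i := by
  have := le_div_of_weight_nonneg hz hw
  unfold sentPiece
  split_ifs <;> omega

theorem sentPiece_nonpos {t : ℤ} {m : Mass} (hz : 1 ≤ m.z) (hw : weight t m ≤ 0) (i : ℕ) :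
    sentPiece m i ≤ t := by
  have h1 := div_le_of_weight_nonpos hz hw
  have h2 := Int.mul_ediv_add_emod m.y m.z
  unfold sentPiece
  split_ifs with h
  · rcases h1.lt_or_eq with h3 | h3
    · omega
    · rw [h3] at h2
      unfold weight at hw
      have : (0 : ℤ) ≤ i := by positivity
      nlinarith
  · omega

/-- If the floor equals `t`, the excess is the remainder, and its units go to the first pieces. -/
theorem sentPiece_zero_pos {t : ℤ} {m : Mass} (hz : 1 ≤ m.z) (hw : 0 < weight t m) :
    t < sentPiece m 0 := by
  have h1 := le_div_of_weight_nonneg hz hw.le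
  have h2 := Int.mul_ediv_add_emod m.y m.z
  unfold sentPiece
  split_ifs with h
  · omega
  · rcases h1.lt_or_eq with h3 | h3
    · omega
    · rw [← h3] at h2
      unfold weight at hw
      push_cast at h
      nlinarith

/-- A deficit of at least two leaves two pieces below `t`: the kept one and the last one sent. With
floor `t - 1` the remainder is at most `z - 2`, so piece `z - 2` gets no extra unit. -/
theorem sentPiece_last_neg {t : ℤ} {m : Mass} (hz : 1 < m.z) (hw : weight t m ≤ -2)
    (i : ℕ) (hi : i = m.z - 2) : sentPiece m i < t := by
  have h1 := div_lt_of_weight_neg hz.le (by omega : weight t m < 0)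
  have h2 := Int.mul_ediv_add_emod m.y m.z
  unfold sentPiece
  split_ifs with h
  · rcases (show m.y / (m.z : ℤ) ≤ t - 1 by omega).lt_or_eq with h3 | h3
    · omega
    · rw [h3] at h2
      unfold weight at hw
      have h4 : (i : ℤ) = m.z - 2 := by omega
      nlinarith
  · omega

theorem sentW_nonneg {t : ℤ} {m : Mass} (hz : 1 ≤ m.z) (hw : 0 ≤ weight t m) (j : Fin n)
    (d : ℕ → Fin n) (l : Fin n) : 0 ≤ sentW t j m d l := by
  rcases hz.lt_or_eq with h | h
  · rw [sentW_of_one_lt t j h]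
    have h1 := le_div_of_weight_nonneg hz hw
    refine add_nonneg (Finset.sum_nonneg fun i _ => ?_) ?_
    · have := sentPiece_nonneg hz hw i
      omega
    · split_ifs <;> omega
  · rw [sentW_of_le_one t j h.ge]
    split_ifs <;> omega

theorem sum_sentPiece_nonpos {t : ℤ} {m : Mass} (hz : 1 ≤ m.z) (hw : weight t m ≤ 0)
    (F : Finset ℕ) : ∑ i ∈ F, (sentPiece m i - t) ≤ 0 :=
  Finset.sum_nonpos fun i _ => by
    have := sentPiece_nonpos hz hw i
    omega

theorem sentW_nonpos {t : ℤ} {m : Mass} (hz : 1 ≤ m.z) (hw : weight t m ≤ 0) (j : Fin n)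
    (d : ℕ → Fin n) (l : Fin n) : sentW t j m d l ≤ 0 := by
  rcases hz.lt_or_eq with h | h
  · rw [sentW_of_one_lt t j h]
    have h1 := div_le_of_weight_nonpos hz hw
    refine add_nonpos (sum_sentPiece_nonpos hz hw _) ?_
    split_ifs <;> omega
  · rw [sentW_of_le_one t j h.ge]
    split_ifs <;> omega

theorem sentW_self_neg {t : ℤ} {m : Mass} (hz : 1 ≤ m.z) (hw : weight t m < 0) (j : Fin n)
    (d : ℕ → Fin n) : sentW t j m d j < 0 := by
  rcases hz.lt_or_eq with h | h
  · rw [sentW_of_one_lt t j h, if_pos rfl]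
    have h1 := div_lt_of_weight_neg hz hw
    have := sum_sentPiece_nonpos hz hw.le ((Finset.range (m.z - 1)).filter (fun i => d i = j))
    omega
  · rw [sentW_of_le_one t j h.ge]
    simpa using hw

theorem sentW_pos {t : ℤ} {m : Mass} (hz : 1 < m.z) (hw : 0 < weight t m) (j : Fin n)
    (d : ℕ → Fin n) : 0 < sentW t j m d (d 0) := by
  rw [sentW_of_one_lt t j hz]
  have h1 := le_div_of_weight_nonneg hz.le hw.le
  have h2 := sentPiece_zero_pos hz.le hw
  have h3 := Finset.single_le_sum (f := fun i => sentPiece m i - t)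
    (s := (Finset.range (m.z - 1)).filter (fun i => d i = d 0))
    (fun i _ => by have := sentPiece_nonneg hz.le hw.le i; omega)
    (Finset.mem_filter.2 ⟨Finset.mem_range.2 (by omega), rfl⟩)
  split_ifs <;> omega

theorem sentW_last_neg {t : ℤ} {m : Mass} (hz : 1 < m.z) (hw : weight t m ≤ -2) (j : Fin n)
    (d : ℕ → Fin n) :
    sentW t j m d (d (m.z - 2)) ≤ if d (m.z - 2) = j then -2 else -1 := by
  rw [sentW_of_one_lt t j hz]
  have h1 := div_lt_of_weight_neg hz.le (by omega : weight t m < 0)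
  have h2 := sentPiece_last_neg hz hw _ rfl
  have h3 : ∑ i ∈ (Finset.range (m.z - 1)).filter (fun i => d i = d (m.z - 2)),
      (sentPiece m i - t) ≤ sentPiece m (m.z - 2) - t := by
    have hmem : m.z - 2 ∈ (Finset.range (m.z - 1)).filter (fun i => d i = d (m.z - 2)) :=
      Finset.mem_filter.2 ⟨Finset.mem_range.2 (by omega), rfl⟩
    rw [← Finset.add_sum_erase _ _ hmem]
    have := sum_sentPiece_nonpos hz.le (by omega : weight t m ≤ 0)
      (((Finset.range (m.z - 1)).filter (fun i => d i = d (m.z - 2))).erase (m.z - 2))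
    omega
  split_ifs <;> omega

theorem sum_sentZ {m : Mass} (j : Fin n) (d : ℕ → Fin n) :
    ∑ l, sentZ j m d l = m.z := by
  unfold sentZ
  split_ifs with h
  · rw [Finset.sum_add_distrib, ← Finset.card_eq_sum_card_fiberwise (fun _ _ => by simp)]
    simp; omega
  · simp

theorem sum_range_indicator_lt (N : ℕ) (b : ℤ) (hb : 0 ≤ b) (hbN : b ≤ N) :
    ∑ i ∈ Finset.range N, (if (i : ℤ) < b then (1 : ℤ) else 0) = b := by
  lift b to ℕ using hb
  rw [Finset.sum_boole]
  have : (Finset.range N).filter (fun i : ℕ => (i : ℤ) < (b : ℤ)) = Finset.range b := by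
    ext i
    simp only [Finset.mem_filter, Finset.mem_range]
    omega
  rw [this, Finset.card_range]

theorem sum_sentY {m : Mass} (hz : 1 ≤ m.z) (j : Fin n) (d : ℕ → Fin n) :
    ∑ l, sentY j m d l = m.y := by
  unfold sentY
  split_ifs with h
  · rw [Finset.sum_add_distrib, Finset.sum_fiberwise]
    have h0 : (0 : ℤ) < m.z := by exact_mod_cast hz
    have h1 := Int.emod_lt_of_pos m.y h0
    have h2 := Int.mul_ediv_add_emod m.y m.z
    simp only [sentPiece, Finset.sum_add_distrib]
    -- The remainder is at most `z - 1`, so all extra units fit on the sent pieces.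
    rw [sum_range_indicator_lt _ _ (Int.emod_nonneg _ h0.ne') (by omega)]
    simp only [Finset.sum_const, Finset.card_range, nsmul_eq_mul, Finset.sum_ite_eq',
      Finset.mem_univ, if_true]
    rw [Nat.cast_sub hz]
    push_cast
    linarith
  · simp

theorem sum_sentW (t : ℤ) {m : Mass} (hz : 1 ≤ m.z) (j : Fin n) (d : ℕ → Fin n) :
    ∑ l, sentW t j m d l = weight t m := by
  simp only [sentW, Finset.sum_sub_distrib, ← Finset.mul_sum, sum_sentY hz, weight]
  rw [← Nat.cast_sum, sum_sentZ]

theorem one_le_sentZ_self {m : Mass} (hz : 1 ≤ m.z) (j : Fin n) (d : ℕ → Fin n) :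
    1 ≤ sentZ j m d j := by
  unfold sentZ
  split_ifs <;> omega

theorem one_le_sentZ {m : Mass} (j : Fin n) (d : ℕ → Fin n) {i : ℕ} (hi : i + 1 < m.z) :
    (if d i = j then 2 else 1) ≤ sentZ j m d (d i) := by
  unfold sentZ
  rw [if_pos (show 1 < m.z by omega)]
  have : 0 < ((Finset.range (m.z - 1)).filter (fun r => d r = d i)).card :=
    Finset.card_pos.2 ⟨i, Finset.mem_filter.2 ⟨Finset.mem_range.2 (by omega), rfl⟩⟩
  by_cases h : d i = j
  · rw [if_pos h, if_pos h]
    omega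
  · rw [if_neg h, if_neg h]
    omega

theorem sentY_eq_zero {m : Mass} (hz : 1 ≤ m.z) (j : Fin n) (d : ℕ → Fin n) {l : Fin n}
    (h : sentZ j m d l = 0) : sentY j m d l = 0 := by
  have hl : l ≠ j := by
    rintro rfl
    have := one_le_sentZ_self hz l d
    omega
  unfold sentZ at h
  unfold sentY
  simp only [if_neg hl, add_zero] at h ⊢
  split_ifs at h ⊢
  · rw [Finset.card_eq_zero] at h
    simp [h]
  · rfl

theorem sentY_self_of_sentZ_self {m : Mass} (j : Fin n) (d : ℕ → Fin n)
    (h : sentZ j m d j = 1) : sentY j m d j = m.y / (m.z : ℤ) := by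
  unfold sentZ at h
  unfold sentY
  simp only [if_true] at h ⊢
  split_ifs at h ⊢
  · rw [Nat.add_eq_right, Finset.card_eq_zero] at h
    simp [h]
  · simp [h]

variable {s : Fin n → Mass}

theorem one_le_step_z (hs : ∀ j, 1 ≤ (s j).z) (x : Fin n × ℕ → Fin n) (j : Fin n) :
    1 ≤ (step s x j).z :=
  (one_le_sentZ_self (hs j) j _).trans
    (Finset.single_le_sum (f := fun i => sentZ i (s i) (fun r => x (i, r)) j)
      (fun _ _ => Nat.zero_le _) (Finset.mem_univ j))

/-- Every node keeps a piece, so wherever a sent piece lands it finds another one, and the receiver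
can send in turn. -/
theorem two_le_step_z (hs : ∀ j, 1 ≤ (s j).z) (x : Fin n × ℕ → Fin n) {v : Fin n} {i : ℕ}
    (hi : i + 1 < (s v).z) : 2 ≤ (step s x (x (v, i))).z := by
  have h1 := one_le_sentZ v (fun r => x (v, r)) hi
  simp only [step]
  by_cases h : x (v, i) = v
  · rw [if_pos h] at h1
    exact h1.trans (Finset.single_le_sum
      (f := fun j => sentZ j (s j) (fun r => x (j, r)) (x (v, i)))
      (fun _ _ => Nat.zero_le _) (Finset.mem_univ v))
  · rw [if_neg h] at h1
    have h2 := one_le_sentZ_self (hs (x (v, i))) (x (v, i)) (fun r => x (x (v, i), r))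
    have h3 := Finset.add_le_sum
      (f := fun j => sentZ j (s j) (fun r => x (j, r)) (x (v, i)))
      (fun _ _ => Nat.zero_le _) (Finset.mem_univ v) (Finset.mem_univ (x (v, i))) (Ne.symm h)
    omega

theorem sum_step_z (s : Fin n → Mass) (x : Fin n × ℕ → Fin n) :
    ∑ j, (step s x j).z = ∑ j, (s j).z := by
  simp only [step]
  rw [Finset.sum_comm]
  exact Finset.sum_congr rfl fun i _ => sum_sentZ i _

theorem sum_weight_step (t : ℤ) (hs : ∀ j, 1 ≤ (s j).z) (x : Fin n × ℕ → Fin n) :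
    ∑ j, weight t (step s x j) = ∑ j, weight t (s j) := by
  simp only [weight_step]
  rw [Finset.sum_comm]
  exact Finset.sum_congr rfl fun i _ => sum_sentW t (hs i) i _

/-- The only piece present is then the one the node kept itself. -/
theorem step_div_of_z_eq_one (hs : ∀ j, 1 ≤ (s j).z) (x : Fin n × ℕ → Fin n) {j : Fin n}
    (h : (step s x j).z = 1) : (step s x j).y = (s j).y / ((s j).z : ℤ) := by
  simp only [step] at h ⊢
  have h1 := one_le_sentZ_self (hs j) j (fun r => x (j, r))
  have h2 := Finset.add_sum_erase Finset.univ
    (fun i => sentZ i (s i) (fun r => x (i, r)) j) (Finset.mem_univ j)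
  have h3 : ∑ i ∈ Finset.univ.erase j, sentZ i (s i) (fun r => x (i, r)) j = 0 := by omega
  rw [Finset.sum_eq_single j, sentY_self_of_sentZ_self j _ (by omega)]
  · intro i _ hij
    exact sentY_eq_zero (hs i) i _ (Finset.sum_eq_zero_iff.1 h3 i (by simp [hij]))
  · simp

end Dynamics

/-! ### The potential function and the strategies that decrease it -/

section Rank

variable {n : ℕ}

/-- The total excess over `t`. -/
def posTotal (t : ℤ) (s : Fin n → Mass) : ℕ := ∑ j, (weight t (s j)).toNat

/-- The total deficit below `t`. -/
def negTotal (t : ℤ) (s : Fin n → Mass) : ℕ := ∑ j, (-weight t (s j)).toNat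

/-- The mass that can be exchanged between nodes above and nodes below `t`. -/
def imbalance (t : ℤ) (s : Fin n → Mass) : ℕ := min (posTotal t s) (negTotal t s)

/-- Some node above `t` sends pieces. -/
def Active (t : ℤ) (s : Fin n → Mass) : Prop := ∃ j, 0 < weight t (s j) ∧ 2 ≤ (s j).z

open Classical in
/-- The imbalance at `t`, refined so as to decrease also when an excess starts to move. -/
def levelRank (t : ℤ) (s : Fin n → Mass) : ℕ :=
  if imbalance t s = 0 then 0 else 2 * imbalance t s + if Active t s then 0 else 1

/-- The number of nodes at which the average piece is exactly `t`. -/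
def exactCount (t : ℤ) (s : Fin n → Mass) : ℕ := (Finset.univ.filter fun j => weight t (s j) = 0).card

/-- The number of successes that are still needed before the states `q^s` are settled. -/
def rank (f c : ℤ) (s : Fin n → Mass) : ℕ :=
  if imbalance c s = 0 ∧ imbalance f s = 0 then
    exactCount c s - (n - (-∑ j, weight c (s j)).toNat)
  else n + levelRank c s + levelRank f s

variable {s : Fin n → Mass} {t : ℤ}

theorem posTotal_eq (t : ℤ) (s : Fin n → Mass) :
    (posTotal t s : ℤ) = negTotal t s + ∑ j, weight t (s j) := by
  simp only [posTotal, negTotal, Nat.cast_sum, ← Finset.sum_add_distrib]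
  exact Finset.sum_congr rfl fun j _ => by omega

theorem toNat_sum_le {ι : Type*} (F : Finset ι) (a : ι → ℤ) :
    (∑ i ∈ F, a i).toNat ≤ ∑ i ∈ F, (a i).toNat := by
  rw [Int.toNat_le, Nat.cast_sum]
  exact Finset.sum_le_sum fun i _ => Int.self_le_toNat _

theorem toNat_sum_lt {ι : Type*} {F : Finset ι} {a : ι → ℤ} {i k : ι} (hi : i ∈ F) (hk : k ∈ F)
    (hpos : 0 < a i) (hneg : a k < 0) : (∑ i ∈ F, a i).toNat < ∑ i ∈ F, (a i).toNat := by
  have h1 : ∑ i ∈ F, a i < ∑ i ∈ F, ((a i).toNat : ℤ) :=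
    Finset.sum_lt_sum (fun i _ => Int.self_le_toNat _) ⟨k, hk, by omega⟩
  have h2 := Finset.single_le_sum (f := fun i => (a i).toNat) (fun _ _ => Nat.zero_le _) hi
  rw [← Nat.cast_sum] at h1
  have h3 : 0 < (a i).toNat := by omega
  omega

/-- All pieces of a node have charges of one weak sign, so positive parts add up without loss. -/
theorem sum_toNat_sentW {m : Mass} (hz : 1 ≤ m.z) (j : Fin n) (d : ℕ → Fin n) :
    ∑ l, (sentW t j m d l).toNat = (weight t m).toNat := by
  zify
  rcases le_total 0 (weight t m) with h | h
  · rw [Int.toNat_of_nonneg h, ← sum_sentW t hz j d]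
    exact Finset.sum_congr rfl fun l _ => Int.toNat_of_nonneg (sentW_nonneg hz h j d l)
  · rw [Int.toNat_of_nonpos h, Nat.cast_zero]
    refine Finset.sum_eq_zero fun l _ => ?_
    rw [Int.toNat_of_nonpos (sentW_nonpos hz h j d l), Nat.cast_zero]

theorem posTotal_eq_sum_sentW (hs : ∀ j, 1 ≤ (s j).z) (x : Fin n × ℕ → Fin n) :
    posTotal t s = ∑ l, ∑ i, (sentW t i (s i) (fun r => x (i, r)) l).toNat := by
  rw [Finset.sum_comm]
  exact Finset.sum_congr rfl fun i _ => (sum_toNat_sentW (hs i) i _).symm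

theorem posTotal_step_le (hs : ∀ j, 1 ≤ (s j).z) (x : Fin n × ℕ → Fin n) :
    posTotal t (step s x) ≤ posTotal t s := by
  rw [posTotal_eq_sum_sentW hs x]
  refine Finset.sum_le_sum fun l _ => ?_
  rw [weight_step]
  exact toNat_sum_le _ _

theorem posTotal_step_lt (hs : ∀ j, 1 ≤ (s j).z) (x : Fin n × ℕ → Fin n) {i k l : Fin n}
    (hi : 0 < sentW t i (s i) (fun r => x (i, r)) l)
    (hk : sentW t k (s k) (fun r => x (k, r)) l < 0) :
    posTotal t (step s x) < posTotal t s := by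
  rw [posTotal_eq_sum_sentW hs x]
  refine Finset.sum_lt_sum (fun l _ => ?_) ⟨l, Finset.mem_univ _, ?_⟩
  · rw [weight_step]
    exact toNat_sum_le _ _
  · rw [weight_step]
    exact toNat_sum_lt (a := fun i => sentW t i (s i) (fun r => x (i, r)) l)
      (Finset.mem_univ i) (Finset.mem_univ k) hi hk

/-- By conservation of charge, `posTotal` and `negTotal` change by the same amount. -/
theorem imbalance_step_le (hs : ∀ j, 1 ≤ (s j).z) (x : Fin n × ℕ → Fin n) :
    imbalance t (step s x) ≤ imbalance t s := by
  have h1 := posTotal_eq t s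
  have h2 := posTotal_eq t (step s x)
  rw [sum_weight_step t hs x] at h2
  have h3 := posTotal_step_le (t := t) hs x
  unfold imbalance
  omega

theorem imbalance_step_lt (hs : ∀ j, 1 ≤ (s j).z) (x : Fin n × ℕ → Fin n) {i k l : Fin n}
    (hi : 0 < sentW t i (s i) (fun r => x (i, r)) l)
    (hk : sentW t k (s k) (fun r => x (k, r)) l < 0) :
    imbalance t (step s x) < imbalance t s := by
  have h1 := posTotal_eq t s
  have h2 := posTotal_eq t (step s x)
  rw [sum_weight_step t hs x] at h2
  have h3 := posTotal_step_lt hs x hi hk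
  unfold imbalance
  omega

theorem weight_step_pos (hs : ∀ j, 1 ≤ (s j).z) (x : Fin n × ℕ → Fin n)
    (h : ¬ imbalance t (step s x) < imbalance t s) {i l : Fin n}
    (hi : 0 < sentW t i (s i) (fun r => x (i, r)) l) : 0 < weight t (step s x l) := by
  rw [weight_step]
  refine Finset.sum_pos' (fun k _ => ?_) ⟨i, Finset.mem_univ _, hi⟩
  by_contra hk
  exact h (imbalance_step_lt hs x hi (not_le.1 hk))

theorem weight_step_neg (hs : ∀ j, 1 ≤ (s j).z) (x : Fin n × ℕ → Fin n)
    (h : ¬ imbalance t (step s x) < imbalance t s) {i l : Fin n}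
    (hi : sentW t i (s i) (fun r => x (i, r)) l < 0) : weight t (step s x l) < 0 := by
  rw [weight_step]
  refine Finset.sum_neg' (fun k _ => ?_) ⟨i, Finset.mem_univ _, hi⟩
  by_contra hk
  exact h (imbalance_step_lt hs x (not_le.1 hk) hi)

theorem pos_advances (hs : ∀ j, 1 ≤ (s j).z) (x : Fin n × ℕ → Fin n)
    (h : ¬ imbalance t (step s x) < imbalance t s) {v : Fin n}
    (hv : 0 < weight t (s v)) (hz : 2 ≤ (s v).z) :
    0 < weight t (step s x (x (v, 0))) ∧ 2 ≤ (step s x (x (v, 0))).z :=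
  ⟨weight_step_pos hs x h (sentW_pos hz hv v fun r => x (v, r)), two_le_step_z hs x (by omega)⟩

theorem Active.step (ha : Active t s) (hs : ∀ j, 1 ≤ (s j).z) (x : Fin n × ℕ → Fin n)
    (h : ¬ imbalance t (step s x) < imbalance t s) : Active t (step s x) :=
  let ⟨_, hv, hz⟩ := ha
  ⟨_, pos_advances hs x h hv hz⟩

/-- The factor 2 in `levelRank` pays for a possible loss of activity when charges cancel. -/
theorem levelRank_lt_of_imbalance_lt {s' : Fin n → Mass} (h : imbalance t s' < imbalance t s) :
    levelRank t s' < levelRank t s := by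
  unfold levelRank
  split_ifs <;> omega

theorem levelRank_step_le (hs : ∀ j, 1 ≤ (s j).z) (x : Fin n × ℕ → Fin n) :
    levelRank t (step s x) ≤ levelRank t s := by
  by_cases h : imbalance t (step s x) < imbalance t s
  · exact (levelRank_lt_of_imbalance_lt h).le
  · have h1 := imbalance_step_le (t := t) hs x
    have h2 : Active t s → Active t (step s x) := fun ha => ha.step hs x h
    unfold levelRank
    split_ifs <;> first | omega | (exfalso; tauto)

theorem levelRank_step_lt_of_active (hs : ∀ j, 1 ≤ (s j).z) (x : Fin n × ℕ → Fin n)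
    (h0 : imbalance t s ≠ 0) (ha : ¬ Active t s) (ha' : Active t (step s x)) :
    levelRank t (step s x) < levelRank t s := by
  have h1 := imbalance_step_le (t := t) hs x
  unfold levelRank
  rw [if_neg h0, if_neg ha, if_pos ha']
  split_ifs <;> omega

theorem levelRank_le (t : ℤ) (s : Fin n → Mass) : levelRank t s ≤ 3 * imbalance t s := by
  unfold levelRank
  split_ifs <;> omega

theorem exists_pos_neg_of_imbalance_ne_zero (h : imbalance t s ≠ 0) :
    (∃ j, 0 < weight t (s j)) ∧ ∃ j, weight t (s j) < 0 := by
  constructor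
  · by_contra! hc
    refine h (Nat.min_eq_zero_iff.2 (Or.inl (Finset.sum_eq_zero fun j _ => ?_)))
    have := hc j
    omega
  · by_contra! hc
    refine h (Nat.min_eq_zero_iff.2 (Or.inr (Finset.sum_eq_zero fun j _ => ?_)))
    have := hc j
    omega

/-- The invariants of the algorithm, for thresholds `f` and `c` around the average. -/
structure Admissible (f c : ℤ) (s : Fin n → Mass) : Prop where
  one_le : ∀ j, 1 ≤ (s j).z
  sum_z : ∑ j, (s j).z = 2 * n
  sum_nonpos : ∑ j, weight c (s j) ≤ 0
  sum_nonneg : 0 ≤ ∑ j, weight f (s j)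

variable {f c : ℤ}

theorem Admissible.step (h : Admissible f c s) (x : Fin n × ℕ → Fin n) :
    Admissible f c (step s x) where
  one_le := one_le_step_z h.one_le x
  sum_z := by rw [sum_step_z, h.sum_z]
  sum_nonpos := by rw [sum_weight_step _ h.one_le]; exact h.sum_nonpos
  sum_nonneg := by rw [sum_weight_step _ h.one_le]; exact h.sum_nonneg

/-- The sign of the total charge makes `posTotal` the smaller of the two totals. -/
theorem weight_nonpos_of_imbalance_eq_zero (hs : ∑ j, weight t (s j) ≤ 0)
    (h : imbalance t s = 0) (j : Fin n) : weight t (s j) ≤ 0 := by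
  have h1 := posTotal_eq t s
  have h2 : posTotal t s = 0 := by
    unfold imbalance at h
    omega
  have := Finset.sum_eq_zero_iff.1 h2 j (Finset.mem_univ j)
  omega

theorem weight_nonneg_of_imbalance_eq_zero (hs : 0 ≤ ∑ j, weight t (s j))
    (h : imbalance t s = 0) (j : Fin n) : 0 ≤ weight t (s j) := by
  have h1 := posTotal_eq t s
  have h2 : negTotal t s = 0 := by
    unfold imbalance at h
    omega
  have := Finset.sum_eq_zero_iff.1 h2 j (Finset.mem_univ j)
  omega

theorem weight_step_nonpos (hs : ∀ j, 1 ≤ (s j).z) (hw : ∀ j, weight t (s j) ≤ 0)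
    (x : Fin n × ℕ → Fin n) (l k : Fin n) :
    weight t (step s x l) ≤ sentW t k (s k) (fun r => x (k, r)) l := by
  rw [weight_step, ← Finset.add_sum_erase _ _ (Finset.mem_univ k)]
  have : ∑ i ∈ Finset.univ.erase k, sentW t i (s i) (fun r => x (i, r)) l ≤ 0 :=
    Finset.sum_nonpos fun i _ => sentW_nonpos (hs i) (hw i) i _ l
  omega

/-- A negative node keeps a negative piece, and no positive charge exists that could offset it. -/
theorem exact_step_subset (hs : ∀ j, 1 ≤ (s j).z) (hw : ∀ j, weight t (s j) ≤ 0)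
    (x : Fin n × ℕ → Fin n) :
    (Finset.univ.filter fun j => weight t (step s x j) = 0) ⊆
      Finset.univ.filter fun j => weight t (s j) = 0 := by
  intro j hj
  rw [Finset.mem_filter] at hj ⊢
  refine ⟨hj.1, ?_⟩
  by_contra h0
  have h1 := weight_step_nonpos hs hw x j j
  have h2 := sentW_self_neg (hs j) ((hw j).lt_of_ne h0) j (fun r => x (j, r))
  omega

theorem exactCount_le (t : ℤ) (s : Fin n → Mass) : exactCount t s ≤ n :=
  (Finset.card_filter_le _ _).trans (by simp)

/-- The summand `n` in the unbalanced phase dominates `exactCount`, so entering the balanced phase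
cannot raise the rank. -/
theorem rank_step_le (h : Admissible f c s) (x : Fin n × ℕ → Fin n) :
    rank f c (step s x) ≤ rank f c s := by
  have h1 := imbalance_step_le (t := c) h.one_le x
  have h2 := imbalance_step_le (t := f) h.one_le x
  have h3 := levelRank_step_le (t := c) h.one_le x
  have h4 := levelRank_step_le (t := f) h.one_le x
  have h5 := exactCount_le c (step s x)
  have h6 := sum_weight_step c h.one_le x
  unfold rank
  rw [h6]
  by_cases hf : imbalance c s = 0 ∧ imbalance f s = 0
  · have h7 : exactCount c (step s x) ≤ exactCount c s := Finset.card_le_card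
      (exact_step_subset h.one_le (weight_nonpos_of_imbalance_eq_zero h.sum_nonpos hf.1) x)
    rw [if_pos hf, if_pos (by omega)]
    omega
  · rw [if_neg hf]
    split_ifs <;> omega

theorem rank_step_lt_of_levelRank (h : Admissible f c s) (x : Fin n × ℕ → Fin n)
    (hl : levelRank c (step s x) < levelRank c s ∨ levelRank f (step s x) < levelRank f s) :
    rank f c (step s x) < rank f c s := by
  have h3 := levelRank_step_le (t := c) h.one_le x
  have h4 := levelRank_step_le (t := f) h.one_le x
  have h5 := exactCount_le c (step s x)
  have h6 : ¬ (imbalance c s = 0 ∧ imbalance f s = 0) := by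
    rintro ⟨h7, h8⟩
    simp [levelRank, h7, h8] at hl
  unfold rank
  rw [if_neg h6]
  split_ifs <;> omega

/-- Pigeonhole on `2 * n` pieces: the doubling of the initial masses guarantees a sender at all
times. -/
theorem exists_two_le_z (h : Admissible f c s) (hn : 0 < n) : ∃ v, 2 ≤ (s v).z := by
  by_contra! hc
  have : ∑ j, (s j).z ≤ ∑ j : Fin n, 1 := Finset.sum_le_sum fun j _ => by
    have := hc j
    omega
  rw [h.sum_z] at this
  simp at this
  omega

/-- A strategy to decrease the rank from `r`: from the states where `T v` holds, the rank decreases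
when the right piece is sent from `v` along any path to `b`. -/
structure Pursuit (f c : ℤ) (r : ℕ) (T : Fin n → (Fin n → Mass) → Prop) (b : Fin n) : Prop where
  not_target : ∀ s, ¬ T b s
  advance : ∀ s v, Admissible f c s → rank f c s = r → T v s →
    ∃ i, ∀ x : Fin n × ℕ → Fin n, rank f c (step s x) < r ∨ T (x (v, i)) (step s x)

/-- A positive piece is steered to a negative node `b`. Until opposite charges cancel, the carrier
stays positive and able to send, and `b` stays negative. -/
theorem pursuit_of_active {r : ℕ} (ht : t = c ∨ t = f) (b : Fin n) :
    Pursuit f c r (fun v s => 0 < weight t (s v) ∧ 2 ≤ (s v).z ∧ weight t (s b) < 0) b where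
  not_target s h := by omega
  advance s v hs hr := by
    rintro ⟨hv, hz, hb⟩
    refine ⟨0, fun x => or_iff_not_imp_left.2 fun hx => ?_⟩
    have hl : ¬ imbalance t (step s x) < imbalance t s := fun hlt => hx <| hr ▸
      rank_step_lt_of_levelRank hs x (by
        rcases ht with rfl | rfl
        · exact Or.inl (levelRank_lt_of_imbalance_lt hlt)
        · exact Or.inr (levelRank_lt_of_imbalance_lt hlt))
    obtain ⟨h1, h2⟩ := pos_advances hs.one_le x hl hv hz
    exact ⟨h1, h2, weight_step_neg hs.one_le x hl (sentW_self_neg (hs.one_le b) hb b _)⟩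

/-- Here every positive node has a single piece and cannot send. Any movable piece is steered to
such a node `b`; on its arrival `b` becomes active unless charge cancels. -/
theorem pursuit_of_not_active {r : ℕ} (ht : t = c ∨ t = f) (b : Fin n) :
    Pursuit f c r (fun v s => 2 ≤ (s v).z ∧ 0 < weight t (s b) ∧ ¬ Active t s ∧
      imbalance t s ≠ 0) b where
  not_target s h := h.2.2.1 ⟨b, h.2.1, h.1⟩
  advance s v hs hr := by
    rintro ⟨hz, hb, ha, h0⟩
    refine ⟨0, fun x => or_iff_not_imp_left.2 fun hx => ?_⟩
    have hl : ¬ levelRank t (step s x) < levelRank t s := fun hlt => hx <| hr ▸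
      rank_step_lt_of_levelRank hs x (by
        rcases ht with rfl | rfl
        · exact Or.inl hlt
        · exact Or.inr hlt)
    have hi : ¬ imbalance t (step s x) < imbalance t s :=
      fun hlt => hl (levelRank_lt_of_imbalance_lt hlt)
    have hzb : (s b).z ≤ 1 := by
      by_contra hzb
      exact ha ⟨b, hb, by omega⟩
    refine ⟨two_le_step_z hs.one_le x (by omega), weight_step_pos hs.one_le x hi (i := b) ?_,
      fun ha' => hl (levelRank_step_lt_of_active hs.one_le x h0 ha ha'), by omega⟩
    rw [sentW_of_le_one t b hzb, if_pos rfl]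
    exact hb

/-- A node with deficit at least two passes a negative piece on. If it hits an exact node, that node
is lost; otherwise the receiver has deficit at least two. -/
theorem pursuit_of_balanced {r : ℕ} (hr : 0 < r) (hfc : c ≤ f + 1) (b : Fin n) :
    Pursuit f c r (fun v s => imbalance c s = 0 ∧ imbalance f s = 0 ∧ weight c (s v) ≤ -2 ∧
      weight c (s b) = 0) b where
  not_target s h := by omega
  advance s v hs hsr := by
    rintro ⟨h1, h2, hv, hb⟩
    refine ⟨(s v).z - 2, fun x => or_iff_not_imp_left.2 fun hx => ?_⟩
    have hw := weight_nonpos_of_imbalance_eq_zero hs.sum_nonpos h1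
    have hu := weight_nonneg_of_imbalance_eq_zero hs.sum_nonneg h2 v
    -- The two charges of `v` differ by `(c - f) * z ≤ z`, and here by at least 2.
    have hz : 1 < (s v).z := by
      unfold weight at hv hu
      have : (0 : ℤ) ≤ (s v).z := by positivity
      have : (2 : ℤ) ≤ (s v).z := by nlinarith
      omega
    have h3 := imbalance_step_le (t := c) hs.one_le x
    have h4 := imbalance_step_le (t := f) hs.one_le x
    have h5 := exact_step_subset hs.one_le hw x
    have h6 : ∀ j, weight c (s j) = 0 → weight c (step s x j) = 0 := by
      by_contra! hc
      obtain ⟨j, hj, hj'⟩ := hc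
      have hlt : exactCount c (step s x) < exactCount c s := Finset.card_lt_card
        (Finset.ssubset_iff_subset_ne.2 ⟨h5, fun he => hj' (by
          have := he ▸ (Finset.mem_filter.2 ⟨Finset.mem_univ j, hj⟩ :
            j ∈ Finset.univ.filter fun j => weight c (s j) = 0)
          exact (Finset.mem_filter.1 this).2)⟩)
      apply hx
      unfold rank at hsr ⊢
      rw [if_pos ⟨h1, h2⟩] at hsr
      rw [if_pos (by omega), sum_weight_step c hs.one_le]
      omega
    refine ⟨by omega, by omega, ?_, h6 b hb⟩
    have h7 := sentW_last_neg hz hv v (fun r => x (v, r))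
    have h8 := weight_step_nonpos hs.one_le hw x (x (v, (s v).z - 2)) v
    by_cases hvv : x (v, (s v).z - 2) = v
    · rw [if_pos hvv] at h7
      omega
    · rw [if_neg hvv] at h7
      set l := x (v, (s v).z - 2) with hl
      -- The receiver was not exact, so its own kept piece and the arriving one are both negative.
      have h9 : weight c (s l) ≠ 0 := fun h0 => by
        have := h6 l h0
        omega
      have h10 := sentW_self_neg (hs.one_le l) ((hw l).lt_of_ne h9) l (fun r => x (l, r))
      rw [weight_step, ← Finset.add_sum_erase _ _ (Finset.mem_univ l),
        ← Finset.add_sum_erase _ _ (Finset.mem_erase.2 ⟨Ne.symm hvv, Finset.mem_univ v⟩)]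
      have h11 : ∑ i ∈ (Finset.univ.erase l).erase v, sentW c i (s i) (fun r => x (i, r)) l ≤ 0 :=
        Finset.sum_nonpos fun i _ => sentW_nonpos (hs.one_le i) (hw i) i _ l
      omega

theorem exists_pursuit (hn : 0 < n) (hfc : c ≤ f + 1) (hs : Admissible f c s)
    (hr : 0 < rank f c s) :
    ∃ T b v, Pursuit f c (rank f c s) T b ∧ T v s := by
  have key : ∀ t, t = c ∨ t = f → imbalance t s ≠ 0 →
      ∃ T b v, Pursuit f c (rank f c s) T b ∧ T v s := by
    intro t ht h0
    obtain ⟨⟨a, ha⟩, b, hb⟩ := exists_pos_neg_of_imbalance_ne_zero h0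
    by_cases hact : Active t s
    · obtain ⟨v, hv, hz⟩ := hact
      exact ⟨_, b, v, pursuit_of_active ht b, hv, hz, hb⟩
    · obtain ⟨v, hv⟩ := exists_two_le_z hs hn
      exact ⟨_, a, v, pursuit_of_not_active ht a, hv, ha, hact, h0⟩
  by_cases h1 : imbalance c s = 0
  swap
  · exact key c (Or.inl rfl) h1
  by_cases h2 : imbalance f s = 0
  swap
  · exact key f (Or.inr rfl) h2
  have hw := weight_nonpos_of_imbalance_eq_zero hs.sum_nonpos h1
  have hr' := hr
  unfold rank at hr'
  rw [if_pos ⟨h1, h2⟩] at hr'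
  obtain ⟨b, hb⟩ : ∃ b, weight c (s b) = 0 := by
    by_contra! hc
    have : exactCount c s = 0 := by
      rw [exactCount, Finset.card_eq_zero, Finset.filter_eq_empty_iff]
      exact fun j _ => hc j
    omega
  -- If all charges were `0` or `-1`, `exactCount` would equal `n` minus the deficit and the rank
  -- would be zero.
  obtain ⟨v, hv⟩ : ∃ v, weight c (s v) ≤ -2 := by
    by_contra! hc
    have h3 : ∑ j, weight c (s j) = ∑ j, ((if weight c (s j) = 0 then (1 : ℤ) else 0) - 1) :=
      Finset.sum_congr rfl fun j _ => by
        have := hc j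
        have := hw j
        split_ifs <;> omega
    have h5 := hs.sum_nonpos
    have h4 : ∑ j, (if weight c (s j) = 0 then (1 : ℤ) else 0) = exactCount c s := by
      rw [Finset.sum_boole]
      rfl
    rw [Finset.sum_sub_distrib, h4] at h3
    simp only [Finset.sum_const, Finset.card_univ, Fintype.card_fin, nsmul_eq_mul, mul_one] at h3
    omega
  exact ⟨_, b, v, pursuit_of_balanced hr hfc b, h1, h2, hv, hb⟩

end Rank

/-! ### Markov property and the transition operator -/

section Probability

variable {n : ℕ}

/-- The law of the choices made in one time step. -/
def stepMeasure (G : Digraph (Fin n)) : Measure (Fin n × ℕ → Fin n) :=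
  Measure.infinitePi fun a : Fin n × ℕ => (choiceLaw G a.1).toMeasure

instance (G : Digraph (Fin n)) : IsProbabilityMeasure (stepMeasure G) := by
  unfold stepMeasure
  infer_instance

instance (G : Digraph (Fin n)) : IsProbabilityMeasure (choiceMeasure G) := by
  unfold choiceMeasure
  infer_instance

/-- Put the choices of one time step in front of a sequence of choices. -/
def consChoices (p : (Fin n × ℕ → Fin n) × Choices n) : Choices n
  | (0, a) => p.1 a
  | (k + 1, a) => p.2 (k, a)

theorem measurable_consChoices : Measurable (consChoices (n := n)) := by
  rw [measurable_pi_iff]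
  rintro ⟨_ | k, a⟩ <;> simp only [consChoices] <;> fun_prop

/-- Time homogeneity: the first step is independent of the later ones, whose shifted law is
unchanged. It suffices to compare finite boxes. -/
theorem map_consChoices (G : Digraph (Fin n)) :
    ((stepMeasure G).prod (choiceMeasure G)).map consChoices = choiceMeasure G := by
  classical
  refine Measure.eq_infinitePi _ fun F t ht => ?_
  have hi : Function.Injective fun a : Fin n × ℕ => ((0 : ℕ), a) := fun a b h => by simpa using h
  have hj : Function.Injective fun a : ℕ × Fin n × ℕ => (a.1 + 1, a.2) := fun a b h => by
    simpa [Prod.ext_iff] using h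
  have hpre : consChoices ⁻¹' (Set.pi F t) =
      (Set.pi (F.preimage (fun a : Fin n × ℕ => ((0 : ℕ), a)) hi.injOn) fun a => t (0, a)) ×ˢ
      (Set.pi (F.preimage (fun a : ℕ × Fin n × ℕ => (a.1 + 1, a.2)) hj.injOn)
        fun a => t (a.1 + 1, a.2)) := by
    ext ⟨x, ω⟩
    simp only [Set.mem_preimage, Set.mem_pi, Set.mem_prod, Finset.coe_preimage, Finset.mem_coe]
    constructor
    · exact fun h => ⟨fun a ha => h (0, a) ha, fun a ha => h (a.1 + 1, a.2) ha⟩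
    · rintro ⟨h1, h2⟩ ⟨_ | k, a⟩ ha
      · exact h1 a ha
      · exact h2 (k, a) ha
  rw [Measure.map_apply measurable_consChoices
    (MeasurableSet.pi F.countable_toSet fun a _ => ht a), hpre, Measure.prod_prod, stepMeasure,
    choiceMeasure, Measure.infinitePi_pi _ fun a _ => ht _, Measure.infinitePi_pi _ fun a _ => ht _,
    ← Finset.prod_filter_mul_prod_filter_not F (fun a => a.1 = 0)]
  congr 1
  · rw [Finset.prod_preimage' (fun a : Fin n × ℕ => ((0 : ℕ), a)) F hi.injOn
      (fun a => (choiceLaw G a.2.1).toMeasure (t a))]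
    refine Finset.prod_congr (Finset.filter_congr fun a _ => ?_) fun _ _ => rfl
    obtain ⟨_ | k, a⟩ := a <;> simp
  · rw [Finset.prod_preimage' (fun a : ℕ × Fin n × ℕ => (a.1 + 1, a.2)) F hj.injOn
      (fun a => (choiceLaw G a.2.1).toMeasure (t a))]
    refine Finset.prod_congr (Finset.filter_congr fun a _ => ?_) fun _ _ => rfl
    obtain ⟨_ | k, a⟩ := a <;> simp

/-- The masses at time step `k` if they are `s` at time step `0`. -/
def massFrom (s : Fin n → Mass) (ω : Choices n) : ℕ → Fin n → Mass
  | 0 => s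
  | k + 1 => step (massFrom s ω k) fun a => ω (k, a)

theorem mass_eq_massFrom (y₀ : Fin n → ℤ) (ω : Choices n) (k : ℕ) :
    mass y₀ ω k = massFrom (fun j => ⟨2 * y₀ j, 2⟩) ω k := by
  induction k with
  | zero => rfl
  | succ k ih =>
    funext j
    simp only [mass, massFrom, step, ih]

theorem massFrom_consChoices (s : Fin n → Mass) (p : (Fin n × ℕ → Fin n) × Choices n) (k : ℕ) :
    massFrom s (consChoices p) (k + 1) = massFrom (step s p.1) p.2 k := by
  induction k with
  | zero => rfl
  | succ k ih =>
    rw [massFrom, ih]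
    rfl

/-- A step from a fixed state reads finitely many draws, so the event comes from a finite space. -/
theorem measurableSet_step_mem (s : Fin n → Mass) (A : Set (Fin n → Mass)) :
    MeasurableSet {x : Fin n × ℕ → Fin n | step s x ∈ A} := by
  let N := ∑ j, (s j).z
  let restr : (Fin n × ℕ → Fin n) → (Fin n × Fin N → Fin n) := fun x a => x (a.1, a.2)
  let ext : (Fin n × Fin N → Fin n) → (Fin n × ℕ → Fin n) :=
    -- The default `a.1` is never read: `N` bounds every `z`.
    fun y a => if h : a.2 < N then y (a.1, ⟨a.2, h⟩) else a.1
  have hm : Measurable restr := by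
    rw [measurable_pi_iff]
    intro a
    exact measurable_pi_apply _
  have hd : ∀ x j r, r < (s j).z → ext (restr x) (j, r) = x (j, r) := by
    intro x j r hr
    have : r < N := hr.trans_le (Finset.single_le_sum (f := fun j => (s j).z)
      (fun _ _ => Nat.zero_le _) (Finset.mem_univ j))
    simp [ext, restr, this]
  have hs : ∀ x, step s (ext (restr x)) = step s x := by
    intro x
    have hfil : ∀ i j, ((Finset.range ((s i).z - 1)).filter fun r => ext (restr x) (i, r) = j) =
        (Finset.range ((s i).z - 1)).filter fun r => x (i, r) = j := by
      intro i j
      refine Finset.filter_congr fun r hr => ?_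
      rw [Finset.mem_range] at hr
      rw [hd x i r (by omega)]
    funext j
    simp only [step, sentY, sentZ, hfil]
  have : {x : Fin n × ℕ → Fin n | step s x ∈ A} = restr ⁻¹' {y | step s (ext y) ∈ A} := by
    ext x
    simp [hs]
  rw [this]
  exact hm (Set.toFinite _).measurableSet

instance : Countable Mass :=
  Function.Injective.countable (f := fun m : Mass => (m.y, m.z)) fun a b h => by
    cases a
    cases b
    simpa using h

theorem measurableSet_massFrom_mem (s : Fin n → Mass) (k : ℕ) (A : Set (Fin n → Mass)) :
    MeasurableSet {ω : Choices n | massFrom s ω k ∈ A} := by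
  induction k generalizing A with
  | zero => exact MeasurableSet.const (s ∈ A)
  | succ k ih =>
    -- There are countably many states, so one may split over the state at time `k`.
    have : {ω : Choices n | massFrom s ω (k + 1) ∈ A} = ⋃ s', {ω | massFrom s ω k ∈ ({s'} : Set _)} ∩
        (fun (ω : Choices n) a => ω (k, a)) ⁻¹' {x | step s' x ∈ A} := by
      ext ω
      simp [massFrom]
    rw [this]
    refine MeasurableSet.iUnion fun s' => (ih _).inter ?_
    refine (?_ : Measurable fun (ω : Choices n) a => ω (k, a)) (measurableSet_step_mem s' A)
    fun_prop

/-- The expectation of `g` after one time step. -/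
def transition (G : Digraph (Fin n)) (g : (Fin n → Mass) → ENNReal) (s : Fin n → Mass) : ENNReal :=
  ∫⁻ x, g (step s x) ∂stepMeasure G

theorem choiceMeasure_massFrom_mem (G : Digraph (Fin n)) (A : Set (Fin n → Mass)) (k : ℕ)
    (s : Fin n → Mass) :
    choiceMeasure G {ω | massFrom s ω k ∈ A} = (transition G)^[k] (A.indicator 1) s := by
  induction k generalizing s with
  | zero =>
    by_cases h : s ∈ A <;> simp [massFrom, h]
  | succ k ih =>
    have hm := measurableSet_massFrom_mem s (k + 1) A
    rw [Function.iterate_succ_apply', transition]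
    nth_rw 1 [← map_consChoices G]
    rw [Measure.map_apply measurable_consChoices hm,
      Measure.prod_apply (measurable_consChoices hm)]
    refine lintegral_congr fun x => ?_
    rw [← ih]
    congr 1
    ext ω
    simp [massFrom_consChoices]

variable {G : Digraph (Fin n)} {K : Set (Fin n → Mass)} {g h : (Fin n → Mass) → ENNReal}

theorem transition_mono (hK : ∀ s ∈ K, ∀ x, step s x ∈ K) (hgh : ∀ s ∈ K, g s ≤ h s) :
    ∀ s ∈ K, transition G g s ≤ transition G h s :=
  fun s hs => lintegral_mono fun x => hgh _ (hK s hs x)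

theorem iterate_transition_mono (hK : ∀ s ∈ K, ∀ x, step s x ∈ K) (hgh : ∀ s ∈ K, g s ≤ h s)
    (k : ℕ) : ∀ s ∈ K, (transition G)^[k] g s ≤ (transition G)^[k] h s := by
  induction k with
  | zero => exact hgh
  | succ k ih =>
    simp only [Function.iterate_succ_apply']
    exact transition_mono hK ih

/-- Only constants leave the integral, so `g` need not be measurable. -/
theorem iterate_transition_affine (a : ENNReal) {b : ENNReal} (hb : b ≠ ⊤) (k : ℕ) :
    (transition G)^[k] (fun s => a + b * g s) = fun s => a + b * (transition G)^[k] g s := by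
  induction k with
  | zero => rfl
  | succ k ih =>
    funext s
    rw [Function.iterate_succ_apply', ih, Function.iterate_succ_apply']
    simp only [transition]
    rw [lintegral_add_left measurable_const, lintegral_const_mul' _ _ hb]
    simp

theorem le_transition_of_choice {v w : Fin n} (hw : w ∈ insert v (outNeighbors G v)) (i : ℕ)
    {q : ENNReal} {s : Fin n → Mass} (hq : ∀ x : Fin n × ℕ → Fin n, x (v, i) = w → q ≤ g (step s x)) :
    (1 + (maxOutDegree G : ENNReal))⁻¹ * q ≤ transition G g s := by
  have hm : MeasurableSet ((fun x : Fin n × ℕ → Fin n => x (v, i)) ⁻¹' {w}) :=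
    measurable_pi_apply (v, i) (measurableSet_singleton w)
  have h1 : stepMeasure G ((fun x : Fin n × ℕ → Fin n => x (v, i)) ⁻¹' {w}) =
      choiceLaw G v w := by
    rw [stepMeasure, (measurePreserving_eval_infinitePi
      (fun a : Fin n × ℕ => (choiceLaw G a.1).toMeasure) (v, i)).measure_preimage
        (measurableSet_singleton w).nullMeasurableSet,
      PMF.toMeasure_apply_singleton _ _ (measurableSet_singleton w)]
  have h2 : (1 + (maxOutDegree G : ENNReal))⁻¹ ≤ choiceLaw G v w := by
    rw [choiceLaw, PMF.uniformOfFinset_apply_of_mem _ hw]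
    rw [ENNReal.inv_le_inv]
    have h3 := Finset.card_insert_le v (outNeighbors G v)
    have h4 : outDegree G v ≤ maxOutDegree G := Finset.le_sup (f := outDegree G) (Finset.mem_univ v)
    have h5 : (insert v (outNeighbors G v)).card ≤ 1 + maxOutDegree G := by
      unfold outDegree at h4
      omega
    exact_mod_cast h5
  calc (1 + (maxOutDegree G : ENNReal))⁻¹ * q
      ≤ q * stepMeasure G ((fun x : Fin n × ℕ → Fin n => x (v, i)) ⁻¹' {w}) := by
        rw [h1, mul_comm]
        gcongr
    _ = ∫⁻ x in (fun x : Fin n × ℕ → Fin n => x (v, i)) ⁻¹' {w}, q ∂stepMeasure G := by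
        rw [setLIntegral_const]
    _ ≤ ∫⁻ x in (fun x : Fin n × ℕ → Fin n => x (v, i)) ⁻¹' {w}, g (step s x) ∂stepMeasure G :=
        setLIntegral_mono' hm fun x hx => hq x hx
    _ ≤ transition G g s := setLIntegral_le_lintegral _ _

end Probability

/-! ### Lower bounds on the probability that the rank drops -/

section Hitting

variable {n : ℕ} {G : Digraph (Fin n)} {f c : ℤ}

theorem mem_outNeighbors {v w : Fin n} : w ∈ outNeighbors G v ↔ G.Adj v w := by
  classical
  simp [outNeighbors]

open Classical in
/-- The nodes from which `b` can be reached in `k` steps, where waiting is allowed. -/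
def within (G : Digraph (Fin n)) (b : Fin n) : ℕ → Finset (Fin n)
  | 0 => {b}
  | k + 1 => Finset.univ.filter fun v => ∃ w ∈ insert v (outNeighbors G v), w ∈ within G b k

theorem within_mono (G : Digraph (Fin n)) (b : Fin n) (k : ℕ) :
    within G b k ⊆ within G b (k + 1) := fun v hv =>
  Finset.mem_filter.2 ⟨Finset.mem_univ v, v, Finset.mem_insert_self _ _, hv⟩

theorem mem_within_self (G : Digraph (Fin n)) (b : Fin n) (k : ℕ) : b ∈ within G b k := by
  induction k with
  | zero => simp [within]
  | succ k ih => exact within_mono G b k ih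

theorem exists_adj_within {b v : Fin n} {S : Finset (Fin n)} (hb : b ∈ S) (hv : v ∉ S)
    (h : Relation.ReflTransGen G.Adj v b) : ∃ u w, u ∉ S ∧ w ∈ S ∧ G.Adj u w := by
  induction h using Relation.ReflTransGen.head_induction_on with
  | refl => exact absurd hb hv
  | head hac _ ih =>
    rename_i a d _
    by_cases hd : d ∈ S
    · exact ⟨a, d, hv, hd, hac⟩
    · exact ih hd

/-- Strong connectivity gives an edge into any proper set containing `b`, so each step gains a node.
-/
theorem card_within (hG : StronglyConnected G) (b : Fin n) (k : ℕ) :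
    k + 1 ≤ (within G b k).card ∨ within G b k = Finset.univ := by
  induction k with
  | zero => simp [within]
  | succ k ih =>
    by_cases hu : within G b k = Finset.univ
    · exact Or.inr (Finset.univ_subset_iff.1 (hu ▸ within_mono G b k))
    · left
      obtain ⟨v, hv⟩ : ∃ v, v ∉ within G b k := by
        by_contra! hc
        exact hu (Finset.eq_univ_iff_forall.2 hc)
      obtain ⟨u, w, hu', hw, huw⟩ := exists_adj_within (mem_within_self G b k) hv (hG v b)
      have hmem : u ∈ within G b (k + 1) := Finset.mem_filter.2 ⟨Finset.mem_univ u, w,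
        Finset.mem_insert_of_mem (mem_outNeighbors.2 huw), hw⟩
      have := Finset.card_lt_card (Finset.ssubset_iff_of_subset (within_mono G b k) |>.2
        ⟨u, hmem, hu'⟩)
      have := ih.resolve_right hu
      omega

theorem mem_within (hG : StronglyConnected G) (b v : Fin n) : v ∈ within G b (n - 1) := by
  rcases card_within hG b (n - 1) with h | h
  · have h1 : (within G b (n - 1)).card = Fintype.card (Fin n) := by
      have := Finset.card_le_univ (within G b (n - 1))
      simp only [Fintype.card_fin] at this ⊢
      omega
    rw [(Finset.card_eq_iff_eq_univ _).1 h1]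
    exact Finset.mem_univ v
  · rw [h]
    exact Finset.mem_univ v

theorem one_le_maxOutDegree (hn : 2 ≤ n) (hG : StronglyConnected G) : 1 ≤ maxOutDegree G := by
  rcases Relation.ReflTransGen.cases_head (hG ⟨0, by omega⟩ ⟨1, by omega⟩) with h | ⟨w, hw, -⟩
  · simp at h
  · refine le_trans ?_ (Finset.le_sup (f := outDegree G) (Finset.mem_univ ⟨0, by omega⟩))
    exact Finset.card_pos.2 ⟨w, mem_outNeighbors.2 hw⟩

theorem one_le_iterate_transition {r : ℕ} (k : ℕ) {s : Fin n → Mass} (hs : Admissible f c s)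
    (hr : rank f c s < r) :
    1 ≤ (transition G)^[k] ({s | rank f c s < r}.indicator 1) s := by
  induction k generalizing s with
  | zero => simp [hr]
  | succ k ih =>
    rw [Function.iterate_succ_apply']
    calc (1 : ENNReal) = ∫⁻ _, 1 ∂stepMeasure G := by simp
      _ ≤ _ := lintegral_mono fun x => ih (hs.step x) ((rank_step_le hs x).trans_lt hr)

/-- Follow a path to `b`. Since `T` fails at `b`, the rank must have dropped on the way. -/
theorem Pursuit.le_iterate_transition {r : ℕ} {T : Fin n → (Fin n → Mass) → Prop} {b : Fin n}
    (hT : Pursuit f c r T b) (k : ℕ) {v : Fin n} {s : Fin n → Mass} (hv : v ∈ within G b k)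
    (hs : Admissible f c s) (hr : rank f c s = r) (hTs : T v s) :
    ((1 + (maxOutDegree G : ENNReal))⁻¹) ^ k ≤
      (transition G)^[k] ({s | rank f c s < r}.indicator 1) s := by
  induction k generalizing v s with
  | zero =>
    rw [within, Finset.mem_singleton] at hv
    exact absurd (hv ▸ hTs) (hT.not_target s)
  | succ k ih =>
    obtain ⟨w, hw, hwk⟩ := (Finset.mem_filter.1 hv).2
    obtain ⟨i, hi⟩ := hT.advance s v hs hr hTs
    rw [Function.iterate_succ_apply', pow_succ']
    refine le_transition_of_choice hw i fun x hx => ?_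
    by_cases hlt : rank f c (step s x) < r
    · refine le_trans (pow_le_one₀ (zero_le) ?_) (one_le_iterate_transition k (hs.step x) hlt)
      exact ENNReal.inv_le_one.2 le_self_add
    · have h1 := rank_step_le hs x
      exact ih hwk (hs.step x) (by omega) (hx ▸ (hi x).resolve_left hlt)

theorem rank_decreases (hn : 0 < n) (hfc : c ≤ f + 1) (hG : StronglyConnected G) {r : ℕ}
    (hr : 0 < r) {s : Fin n → Mass} (hs : Admissible f c s) (hsr : rank f c s ≤ r) :
    ENNReal.ofReal ((1 + (maxOutDegree G : ℝ)) ^ (n - 1))⁻¹ ≤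
      (transition G)^[n - 1] ({s | rank f c s < r}.indicator 1) s := by
  have hp : ENNReal.ofReal ((1 + (maxOutDegree G : ℝ)) ^ (n - 1))⁻¹ =
      ((1 + (maxOutDegree G : ENNReal))⁻¹) ^ (n - 1) := by
    rw [ENNReal.ofReal_inv_of_pos (by positivity), ENNReal.ofReal_pow (by positivity),
      ENNReal.ofReal_add (by positivity) (by positivity), ENNReal.inv_pow]
    simp
  rw [hp]
  rcases hsr.lt_or_eq with h | h
  · refine le_trans (pow_le_one₀ (zero_le) ?_) (one_le_iterate_transition _ hs h)
    exact ENNReal.inv_le_one.2 le_self_add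
  · obtain ⟨T, b, v, hT, hv⟩ := exists_pursuit hn hfc hs (h ▸ hr)
    exact (h ▸ hT).le_iterate_transition (n - 1) (mem_within hG b v) hs h hv

theorem admissible_rank_le_step {r : ℕ} :
    ∀ s ∈ {s : Fin n → Mass | Admissible f c s ∧ rank f c s ≤ r}, ∀ x,
      step s x ∈ {s : Fin n → Mass | Admissible f c s ∧ rank f c s ≤ r} :=
  fun _ hs x => ⟨hs.1.step x, (rank_step_le hs.1 x).trans hs.2⟩

/-- Condition on the first window: it succeeds with probability at least `p`, and otherwise the
bound for `M` windows applies to the new state. -/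
theorem rank_decreases_in_windows {r L : ℕ} {p : ℝ} (hp0 : 0 ≤ p) (hp1 : p ≤ 1)
    (h : ∀ s : Fin n → Mass, Admissible f c s → rank f c s ≤ r → ENNReal.ofReal p ≤
      (transition G)^[L] ({s | rank f c s < r}.indicator 1) s) (M : ℕ)
    {s : Fin n → Mass} (hs : Admissible f c s) (hsr : rank f c s ≤ r) :
    ENNReal.ofReal (1 - (1 - p) ^ M) ≤
      (transition G)^[M * L] ({s | rank f c s < r}.indicator 1) s := by
  induction M generalizing s with
  | zero => simp
  | succ M ih =>
    have hb0 : 0 ≤ (1 - p) ^ M := pow_nonneg (by linarith) M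
    have hb1 : (1 - p) ^ M ≤ 1 := pow_le_one₀ (by linarith) (by linarith)
    rw [show (M + 1) * L = L + M * L by ring, Function.iterate_add_apply]
    refine le_trans ?_ (iterate_transition_mono admissible_rank_le_step
      (g := fun s => ENNReal.ofReal (1 - (1 - p) ^ M) + ENNReal.ofReal ((1 - p) ^ M) *
        ({s | rank f c s < r}.indicator 1) s) ?_ L s ⟨hs, hsr⟩)
    · rw [iterate_transition_affine _ ENNReal.ofReal_ne_top]
      beta_reduce
      calc ENNReal.ofReal (1 - (1 - p) ^ (M + 1))
          = ENNReal.ofReal (1 - (1 - p) ^ M) + ENNReal.ofReal ((1 - p) ^ M) * ENNReal.ofReal p := by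
            rw [← ENNReal.ofReal_mul hb0, ← ENNReal.ofReal_add (by linarith) (by positivity)]
            congr 1
            ring
        _ ≤ _ := by
            gcongr
            exact h s hs hsr
    · rintro s' ⟨hs', hsr'⟩
      by_cases hlt : rank f c s' < r
      · refine le_trans (le_of_eq ?_) (one_le_iterate_transition _ hs' hlt)
        rw [Set.indicator_of_mem (s := {s | rank f c s < r}) hlt, Pi.one_apply, mul_one,
          ← ENNReal.ofReal_add (by linarith) hb0, sub_add_cancel, ENNReal.ofReal_one]
      · rw [Set.indicator_of_notMem (s := {s | rank f c s < r}) hlt, mul_zero, add_zero]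
        exact ih hs' hsr'

theorem rank_vanishes {L : ℕ} {a : ENNReal} (ha : a ≤ 1)
    (h : ∀ r, 0 < r → ∀ s : Fin n → Mass, Admissible f c s → rank f c s ≤ r →
      a ≤ (transition G)^[L] ({s | rank f c s < r}.indicator 1) s) (r : ℕ)
    {s : Fin n → Mass} (hs : Admissible f c s) (hsr : rank f c s ≤ r) :
    a ^ r ≤ (transition G)^[r * L] ({s | rank f c s = 0}.indicator 1) s := by
  induction r generalizing s with
  | zero =>
    have : s ∈ {s | rank f c s = 0} := Nat.le_zero.1 hsr
    simp [Set.indicator_of_mem this]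
  | succ r ih =>
    rw [show (r + 1) * L = L + r * L by ring, Function.iterate_add_apply]
    refine le_trans ?_ (iterate_transition_mono admissible_rank_le_step
      (g := fun s => 0 + a ^ r * ({s | rank f c s < r + 1}.indicator 1) s) ?_ L s ⟨hs, hsr⟩)
    · rw [iterate_transition_affine _ (ENNReal.pow_ne_top (ha.trans_lt ENNReal.one_lt_top).ne)]
      beta_reduce
      rw [zero_add, pow_succ]
      gcongr
      exact h (r + 1) (Nat.succ_pos r) s hs hsr
    · rintro s' ⟨hs', -⟩
      by_cases hlt : rank f c s' < r + 1
      · rw [Set.indicator_of_mem (s := {s | rank f c s < r + 1}) hlt, Pi.one_apply, mul_one, zero_add]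
        exact ih hs' (Nat.lt_succ_iff.1 hlt)
      · rw [Set.indicator_of_notMem (s := {s | rank f c s < r + 1}) hlt, mul_zero, zero_add]
        exact zero_le

end Hitting

/-! ### Rank zero means settled; the initial rank -/

section Settling

variable {n : ℕ} {f c : ℤ}

theorem Admissible.massFrom {s : Fin n → Mass} (hs : Admissible f c s) (ω : Choices n) (k : ℕ) :
    Admissible f c (massFrom s ω k) := by
  induction k with
  | zero => exact hs
  | succ k ih => exact ih.step _

/-- Each non-exact node uses at least one unit of the deficit. -/
theorem le_exactCount {s : Fin n → Mass} {t : ℤ} (hw : ∀ j, weight t (s j) ≤ 0) :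
    n - (-∑ j, weight t (s j)).toNat ≤ exactCount t s := by
  have h1 : ∑ j, weight t (s j) ≤ ∑ j, ((if weight t (s j) = 0 then (1 : ℤ) else 0) - 1) :=
    Finset.sum_le_sum fun j _ => by
      have := hw j
      split_ifs <;> omega
  have h2 : ∑ j, (if weight t (s j) = 0 then (1 : ℤ) else 0) = exactCount t s := by
    rw [Finset.sum_boole]
    rfl
  rw [Finset.sum_sub_distrib, h2] at h1
  simp only [Finset.sum_const, Finset.card_univ, Fintype.card_fin, nsmul_eq_mul, mul_one] at h1
  omega

theorem balanced_of_rank_eq_zero (hn : 0 < n) {s : Fin n → Mass} (h : rank f c s = 0) :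
    imbalance c s = 0 ∧ imbalance f s = 0 ∧
      exactCount c s ≤ n - (-∑ j, weight c (s j)).toNat := by
  unfold rank at h
  split_ifs at h with h1
  · exact ⟨h1.1, h1.2, by omega⟩
  · omega

/-- The exact set already has its least possible size, so it cannot shrink. -/
theorem exact_step_iff (hn : 0 < n) {s : Fin n → Mass} (hs : Admissible f c s)
    (h : rank f c s = 0) (x : Fin n × ℕ → Fin n) (j : Fin n) :
    weight c (step s x j) = 0 ↔ weight c (s j) = 0 := by
  have h' : rank f c (step s x) = 0 := Nat.le_zero.1 (h ▸ rank_step_le hs x)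
  obtain ⟨h1, -, h3⟩ := balanced_of_rank_eq_zero hn h
  obtain ⟨h1', -, -⟩ := balanced_of_rank_eq_zero hn h'
  have h4 := le_exactCount (weight_nonpos_of_imbalance_eq_zero (hs.step x).sum_nonpos h1')
  rw [sum_weight_step c hs.one_le] at h4
  have h5 := Finset.eq_of_subset_of_card_le (exact_step_subset hs.one_le
    (weight_nonpos_of_imbalance_eq_zero hs.sum_nonpos h1) x) (h3.trans h4)
  have h6 := Finset.ext_iff.1 h5 j
  simpa only [Finset.mem_filter, Finset.mem_univ, true_and] using h6

theorem div_of_rank_eq_zero (hn : 0 < n) (hfc : c ≤ f + 1) {s : Fin n → Mass}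
    (hs : Admissible f c s) (h : rank f c s = 0) (j : Fin n) :
    (s j).y / ((s j).z : ℤ) = if weight c (s j) = 0 then c else f := by
  obtain ⟨h1, h2, -⟩ := balanced_of_rank_eq_zero hn h
  have hw := weight_nonpos_of_imbalance_eq_zero hs.sum_nonpos h1 j
  have h3 := le_div_of_weight_nonneg (hs.one_le j)
    (weight_nonneg_of_imbalance_eq_zero hs.sum_nonneg h2 j)
  split_ifs with h0
  · exact le_antisymm (div_le_of_weight_nonpos (hs.one_le j) hw)
      (le_div_of_weight_nonneg (hs.one_le j) h0.ge)
  · have := div_lt_of_weight_neg (hs.one_le j) (hw.lt_of_ne h0)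
    omega

theorem one_le_mass_z (y₀ : Fin n → ℤ) (ω : Choices n) (k : ℕ) (j : Fin n) :
    1 ≤ (mass y₀ ω k j).z := by
  induction k generalizing j with
  | zero => simp [mass]
  | succ k ih => exact one_le_step_z ih (fun a => ω (k, a)) j

/-- No memory is needed: a node that skips the refresh holds just its kept piece, whose value is the
previous floor. -/
theorem stateVars_qs (y₀ : Fin n → ℤ) (ω : Choices n) (k : ℕ) (j : Fin n) :
    (stateVars y₀ ω k j).qs = (mass y₀ ω k j).y / ((mass y₀ ω k j).z : ℤ) := by
  induction k with
  | zero => simp [stateVars, refresh, mass]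
  | succ k ih =>
    rw [stateVars, refresh]
    split_ifs with h
    · rfl
    · have hz : (mass y₀ ω (k + 1) j).z = 1 := by
        have := one_le_mass_z y₀ ω (k + 1) j
        omega
      rw [ih, hz, Nat.cast_one, Int.ediv_one]
      exact (step_div_of_z_eq_one (one_le_mass_z y₀ ω k) (fun a => ω (k, a)) hz).symm

theorem settledFrom_of_rank_eq_zero (hn : 0 < n) {y₀ : Fin n → ℤ} {ω : Choices n} {k₀ : ℕ}
    (hs : Admissible ⌊average y₀⌋ ⌈average y₀⌉ fun j => ⟨2 * y₀ j, 2⟩)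
    (h : rank ⌊average y₀⌋ ⌈average y₀⌉ (massFrom (fun j => ⟨2 * y₀ j, 2⟩) ω k₀) = 0) :
    SettledFrom y₀ ω k₀ := by
  have hfc := Int.ceil_le_floor_add_one (average y₀)
  have key : ∀ k, k₀ ≤ k →
      rank ⌊average y₀⌋ ⌈average y₀⌉ (massFrom (fun j => ⟨2 * y₀ j, 2⟩) ω k) = 0 ∧
      ∀ j, weight ⌈average y₀⌉ (massFrom (fun j => ⟨2 * y₀ j, 2⟩) ω k j) = 0 ↔
        weight ⌈average y₀⌉ (massFrom (fun j => ⟨2 * y₀ j, 2⟩) ω k₀ j) = 0 := by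
    intro k hk
    induction k, hk using Nat.le_induction with
    | base => exact ⟨h, fun _ => Iff.rfl⟩
    | succ k _ ih =>
      exact ⟨Nat.le_zero.1 (ih.1 ▸ rank_step_le (hs.massFrom ω k) _),
        fun j => (exact_step_iff hn (hs.massFrom ω k) ih.1 _ j).trans (ih.2 j)⟩
  have hq : ∀ j k, k₀ ≤ k → (stateVars y₀ ω k j).qs =
      if weight ⌈average y₀⌉ (massFrom (fun j => ⟨2 * y₀ j, 2⟩) ω k₀ j) = 0
      then ⌈average y₀⌉ else ⌊average y₀⌋ := by
    intro j k hk
    rw [stateVars_qs, mass_eq_massFrom, div_of_rank_eq_zero hn hfc (hs.massFrom ω k) (key k hk).1]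
    simp only [(key k hk).2 j]
  intro j
  by_cases h0 : weight ⌈average y₀⌉ (massFrom (fun j => ⟨2 * y₀ j, 2⟩) ω k₀ j) = 0
  · exact Or.inr fun k hk => by rw [hq j k hk, if_pos h0]
  · exact Or.inl fun k hk => by rw [hq j k hk, if_neg h0]

theorem sum_weight_initial (t : ℤ) (y₀ : Fin n → ℤ) :
    ∑ j, weight t ⟨2 * y₀ j, 2⟩ = 2 * (∑ j, y₀ j - n * t) := by
  simp only [weight, Finset.sum_sub_distrib, ← Finset.mul_sum, Finset.sum_const, Finset.card_univ,
    Fintype.card_fin, nsmul_eq_mul]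
  push_cast
  ring

theorem sum_eq_mul_average (hn : 0 < n) (y₀ : Fin n → ℤ) :
    ((∑ j, y₀ j : ℤ) : ℝ) = n * average y₀ := by
  have : (n : ℝ) ≠ 0 := by positivity
  rw [average, mul_div_cancel₀ _ this]
  push_cast
  rfl

theorem admissible_initial (hn : 0 < n) (y₀ : Fin n → ℤ) :
    Admissible ⌊average y₀⌋ ⌈average y₀⌉ fun j => ⟨2 * y₀ j, 2⟩ where
  one_le _ := one_le_two
  sum_z := by simp [mul_comm]
  sum_nonpos := by
    have h : ((∑ j, y₀ j : ℤ) : ℝ) ≤ ((n * ⌈average y₀⌉ : ℤ) : ℝ) := by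
      rw [sum_eq_mul_average hn]
      push_cast
      gcongr
      exact Int.le_ceil _
    rw [sum_weight_initial]
    have := Int.cast_le.1 h
    linarith
  sum_nonneg := by
    have h : ((n * ⌊average y₀⌋ : ℤ) : ℝ) ≤ ((∑ j, y₀ j : ℤ) : ℝ) := by
      rw [sum_eq_mul_average hn]
      push_cast
      gcongr
      exact Int.floor_le _
    rw [sum_weight_initial]
    have := Int.cast_le.1 h
    linarith

/-- The 6 is the factor 3 of `levelRank_le` times the doubling of the masses. -/
theorem rank_initial_le (y₀ : Fin n → ℤ) :
    rank ⌊average y₀⌋ ⌈average y₀⌉ (fun j => ⟨2 * y₀ j, 2⟩) ≤ 6 * (yInit y₀ + n) := by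
  have h1 : posTotal ⌈average y₀⌉ (fun j => ⟨2 * y₀ j, 2⟩) =
      2 * ∑ j with ⌈average y₀⌉ < y₀ j, (y₀ j - ⌈average y₀⌉).toNat := by
    rw [posTotal, Finset.sum_filter, Finset.mul_sum]
    refine Finset.sum_congr rfl fun j _ => ?_
    simp only [weight]
    push_cast
    split_ifs <;> omega
  have h2 : negTotal ⌊average y₀⌋ (fun j => ⟨2 * y₀ j, 2⟩) =
      2 * ∑ j with y₀ j < ⌊average y₀⌋, (⌊average y₀⌋ - y₀ j).toNat := by
    rw [negTotal, Finset.sum_filter, Finset.mul_sum]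
    refine Finset.sum_congr rfl fun j _ => ?_
    simp only [weight]
    push_cast
    split_ifs <;> omega
  have h3 := levelRank_le ⌈average y₀⌉ (fun j => (⟨2 * y₀ j, 2⟩ : Mass))
  have h4 := levelRank_le ⌊average y₀⌋ (fun j => (⟨2 * y₀ j, 2⟩ : Mass))
  have h5 := min_le_left (posTotal ⌈average y₀⌉ (fun j => (⟨2 * y₀ j, 2⟩ : Mass)))
    (negTotal ⌈average y₀⌉ (fun j => ⟨2 * y₀ j, 2⟩))
  have h6 := min_le_right (posTotal ⌊average y₀⌋ (fun j => (⟨2 * y₀ j, 2⟩ : Mass)))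
    (negTotal ⌊average y₀⌋ (fun j => ⟨2 * y₀ j, 2⟩))
  have h7 := exactCount_le ⌈average y₀⌉ (fun j => (⟨2 * y₀ j, 2⟩ : Mass))
  rw [← imbalance] at h5 h6
  rw [h1] at h5
  rw [h2] at h6
  unfold rank yInit
  split_ifs <;> omega

end Settling

/-! ### Choice of the number of windows -/

section Bounds

variable {n : ℕ} {G : Digraph (Fin n)}

/-- As `D ≥ 1` and `n ≥ 2`, the base lies strictly between 0 and 1; its logarithm is negative, which
reverses the inequality. -/
theorem pow_windows_le (hn : 2 ≤ n) (hG : StronglyConnected G) {ε : ℝ} (hε : 0 < ε) :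
    (1 - ((1 + (maxOutDegree G : ℝ)) ^ (n - 1))⁻¹) ^ windows G ε ≤ ε := by
  have hD : (1 : ℝ) ≤ maxOutDegree G := by exact_mod_cast one_le_maxOutDegree hn hG
  have h1 : 1 < (1 + (maxOutDegree G : ℝ)) ^ (n - 1) := one_lt_pow₀ (by linarith) (by omega)
  have h2 := inv_lt_one_of_one_lt₀ h1
  have h3 : 0 < ((1 + (maxOutDegree G : ℝ)) ^ (n - 1))⁻¹ := by positivity
  have hlog : Real.log (1 - ((1 + (maxOutDegree G : ℝ)) ^ (n - 1))⁻¹) < 0 :=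
    Real.log_neg (by linarith) (by linarith)
  have h4 := Nat.le_ceil (Real.log ε / Real.log (1 - ((1 + (maxOutDegree G : ℝ)) ^ (n - 1))⁻¹))
  rw [div_le_iff_of_neg hlog] at h4
  rw [← Real.log_le_log_iff (pow_pos (by linarith) _) hε, Real.log_pow]
  exact h4

theorem settles_with_probability (hn : 2 ≤ n) (hG : StronglyConnected G) (y₀ : Fin n → ℤ)
    {ε : ℝ} (hε : 0 < ε) (hε1 : ε < 1) {m : ℕ} (hm : 6 * ε ^ m ≤ 1) :
    (1 - ε) ^ (yInit y₀ + n) ≤ (choiceMeasure G).real {ω | SettledFrom y₀ ω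
      (6 * (yInit y₀ + n) * ((m + 1) * windows G ε * (n - 1)))} := by
  set p : ℝ := ((1 + (maxOutDegree G : ℝ)) ^ (n - 1))⁻¹ with hp
  have hp0 : 0 ≤ p := by positivity
  have hp1 : p ≤ 1 := inv_le_one_of_one_le₀ (one_le_pow₀ (by simp))
  set M := (m + 1) * windows G ε with hM
  have hδ0 : 0 ≤ (1 - p) ^ M := pow_nonneg (by linarith) M
  have hδ : (1 - p) ^ M ≤ ε ^ (m + 1) := by
    rw [hM, mul_comm, pow_mul]
    exact pow_le_pow_left₀ (pow_nonneg (by linarith) _) (pow_windows_le hn hG hε) _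
  have h6 : 6 * (1 - p) ^ M ≤ ε := by
    rw [pow_succ] at hδ
    nlinarith
  have hs := admissible_initial (by omega) y₀
  have h1 := rank_vanishes (G := G) (L := M * (n - 1)) (a := ENNReal.ofReal (1 - (1 - p) ^ M))
    (ENNReal.ofReal_le_one.2 (by linarith))
    (fun r hr s hs hsr => rank_decreases_in_windows hp0 hp1
      (fun s hs hsr => rank_decreases (by omega) (Int.ceil_le_floor_add_one (average y₀)) hG hr
        hs hsr) M hs hsr) _ hs (rank_initial_le y₀)
  rw [← choiceMeasure_massFrom_mem, ← ENNReal.ofReal_pow (by linarith)] at h1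
  have h2 := h1.trans (measure_mono (μ := choiceMeasure G)
    fun ω hω => settledFrom_of_rank_eq_zero (by omega) hs hω)
  have h3 := (ENNReal.ofReal_le_iff_le_toReal (measure_ne_top _ _)).1 h2
  refine le_trans ?_ h3
  rw [pow_mul]
  refine pow_le_pow_left₀ (by linarith) ?_ _
  -- Bernoulli: six units of rank cost together at most `6 * (1 - p) ^ M ≤ ε`.
  have h4 := one_add_mul_le_pow (show (-2 : ℝ) ≤ -(1 - p) ^ M by linarith) 6
  push_cast at h4
  rw [← sub_eq_add_neg] at h4
  linarith

theorem exists_windows_factor {ε₀ : ℝ} (hε₀ : ε₀ < 1) :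
    ∃ m : ℕ, ∀ ε : ℝ, 0 < ε → ε ≤ ε₀ → 6 * ε ^ m ≤ 1 := by
  obtain ⟨m, hm⟩ := exists_pow_lt_of_lt_one (show (0 : ℝ) < 1 / 6 by norm_num) hε₀
  refine ⟨m, fun ε h0 h1 => ?_⟩
  have := pow_le_pow_left₀ h0.le h1 m
  linarith

end Bounds

end MassSplitting

end

theorem theorem1 :
    (∀ (n : ℕ) (_ : 2 ≤ n) (G : Digraph (Fin n)) (_ : ∀ j, ¬ G.Adj j j)
        (_ : MassSplitting.StronglyConnected G) (y₀ : Fin n → ℤ) (ε : ℝ) (_ : 0 < ε) (_ : ε < 1),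
      ∃ k₀ : ℕ,
        (1 - ε) ^ (MassSplitting.yInit y₀ + n) ≤
          (MassSplitting.choiceMeasure G).real {ω | MassSplitting.SettledFrom y₀ ω k₀}) ∧
    (∀ ε₀ : ℝ, ε₀ < 1 → ∃ C : ℝ,
      ∀ (n : ℕ) (_ : 2 ≤ n) (G : Digraph (Fin n)) (_ : ∀ j, ¬ G.Adj j j)
        (_ : MassSplitting.StronglyConnected G) (y₀ : Fin n → ℤ) (ε : ℝ) (_ : 0 < ε) (_ : ε ≤ ε₀),
      ∃ k₀ : ℕ,
        (k₀ : ℝ) ≤ C * ((MassSplitting.yInit y₀ + n : ℕ) : ℝ) * (MassSplitting.windows G ε : ℝ)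
            * ((n : ℝ) - 1) ∧
        (1 - ε) ^ (MassSplitting.yInit y₀ + n) ≤
          (MassSplitting.choiceMeasure G).real {ω | MassSplitting.SettledFrom y₀ ω k₀}) := by
  have hmain : ∀ ε₀ : ℝ, ε₀ < 1 → ∃ C : ℝ,
      ∀ (n : ℕ) (_ : 2 ≤ n) (G : Digraph (Fin n)) (_ : ∀ j, ¬ G.Adj j j)
        (_ : MassSplitting.StronglyConnected G) (y₀ : Fin n → ℤ) (ε : ℝ) (_ : 0 < ε) (_ : ε ≤ ε₀),
      ∃ k₀ : ℕ,
        (k₀ : ℝ) ≤ C * ((MassSplitting.yInit y₀ + n : ℕ) : ℝ) * (MassSplitting.windows G ε : ℝ)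
            * ((n : ℝ) - 1) ∧
        (1 - ε) ^ (MassSplitting.yInit y₀ + n) ≤
          (MassSplitting.choiceMeasure G).real {ω | MassSplitting.SettledFrom y₀ ω k₀} := by
    intro ε₀ hε₀
    obtain ⟨m, hm⟩ := MassSplitting.exists_windows_factor hε₀
    refine ⟨6 * (m + 1), fun n hn G _ hG y₀ ε h0 h1 => ⟨_, le_of_eq ?_,
      MassSplitting.settles_with_probability hn hG y₀ h0 (h1.trans_lt hε₀) (hm ε h0 h1)⟩⟩
    push_cast [Nat.cast_sub (show 1 ≤ n by omega)]
    ring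
  refine ⟨fun n hn G hG hc y₀ ε h0 h1 => ?_, hmain⟩
  obtain ⟨C, hC⟩ := hmain ε h1
  obtain ⟨k₀, -, hk⟩ := hC n hn G hG hc y₀ ε h0 le_rfl
  exact ⟨k₀, hk⟩
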